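/- Let $A$ be a nonzero complex Banach algebra with unit $1$. For $a,b\in A$ let $C_{a,b}$ be the bounded linear operator on $A$ given by $C_{a,b}x=ax-xb$, and put \[\rho(a,b)=\limsup_{n\to\infty}\|C_{a,b}^n 1\|^{1/n},\qquad d(a,b)=\max\{\rho(a,b),\rho(b,a)\}.\] An element $r\in A$ is called quasinilpotent if its spectrum is $\sigma(r)=\{0\}$. Let $a,b\in A$ and suppose that $\sigma(a)$ is finite. Then $d(a,b)=0$ if and only if there exist quasinilpotent elements $r_a,r_b\in A$ such that $r_a$ commutes with $a$, $r_b$ commutes with $b$, and $a-b=r_a-r_b$. -/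

import Mathlib

open Filter

noncomputable section

namespace QuasinilpotentEquivalence

variable {A : Type*} [NormedRing A] [NormedAlgebra ℂ A]

/-- An element is quasinilpotent if its spectrum is `{0}`. -/
def IsQuasinilpotent (a : A) : Prop :=
  spectrum ℂ a = {0}

/-- The bounded operator `C_{a,b} = L_a - R_b`, that is `x ↦ a * x - x * b`, on `A`. -/
def commutatorOp (a b : A) : A →L[ℂ] A :=
  ContinuousLinearMap.mul ℂ A a - (ContinuousLinearMap.mul ℂ A).flip b

theorem commutatorOp_apply (a b x : A) : commutatorOp a b x = a * x - x * b := rfl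

/-- `ρ(a,b) = limsup_n ‖C_{a,b}^n 1‖^{1/n}`. -/
def rho (a b : A) : ℝ :=
  limsup (fun n : ℕ => ‖(commutatorOp a b ^ n) 1‖ ^ (1 / (n : ℝ))) atTop

/-- The sequence in the definition of `rho` is bounded above, so its real `limsup` is the
usual one. -/
theorem rho_isBoundedUnder (a b : A) :
    IsBoundedUnder (· ≤ ·) atTop
      (fun n : ℕ => ‖(commutatorOp a b ^ n) 1‖ ^ (1 / (n : ℝ))) := by
  set M : ℝ := max 1 ‖(1 : A)‖ with hM
  set K : ℝ := ‖commutatorOp a b‖ with hK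
  have hM1 : 1 ≤ M := le_max_left _ _
  have hK0 : 0 ≤ K := norm_nonneg _
  refine isBoundedUnder_of_eventually_le (a := K * M) ?_
  filter_upwards [eventually_ge_atTop 1] with n hn
  have h1 : ‖(commutatorOp a b ^ n) 1‖ ≤ (K * M) ^ n := by
    calc ‖(commutatorOp a b ^ n) 1‖ ≤ ‖commutatorOp a b ^ n‖ * ‖(1 : A)‖ :=
          ContinuousLinearMap.le_opNorm _ _
      _ ≤ K ^ n * M ^ n := by
          refine mul_le_mul (norm_pow_le' _ (by omega)) ?_ (norm_nonneg _) (by positivity)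
          exact (le_max_right _ _).trans (le_self_pow₀ hM1 (by omega))
      _ = (K * M) ^ n := (mul_pow _ _ _).symm
  calc ‖(commutatorOp a b ^ n) 1‖ ^ (1 / (n : ℝ)) ≤ ((K * M) ^ n) ^ (1 / (n : ℝ)) :=
        Real.rpow_le_rpow (norm_nonneg _) h1 (by positivity)
    _ = K * M := by
        rw [one_div]
        exact Real.pow_rpow_inv_natCast (by positivity) (by omega)

/-- The spectral semidistance `d(a,b) = max {ρ(a,b), ρ(b,a)}`. -/
def specDist (a b : A) : ℝ :=
  max (rho a b) (rho b a)

end QuasinilpotentEquivalence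

end

noncomputable section

namespace QuasinilpotentEquivalence

/-! Write a ~ b when `C_{a,b}^n 1` and `C_{b,a}^n 1` decay faster than every geometric sequence,
that is, when d(a,b) = 0. The Leibniz rule `C_{a,c}(xy) = C_{a,b}(x) y + x C_{b,c}(y)` makes ~
transitive (`DecaysFast.commutatorOp_mul`). Since a has finite spectrum, a = c + q with q
quasinilpotent, c = ∑ k • f k diagonal and c, q commuting, so c ~ a ~ b. The Leibniz rule, with b as
second factor, then shows that `C_{c,c}^n b` decays fast. Its (j,i) block is `(j - i)^n • (f j * b *
f i)`, so the off-diagonal blocks of b vanish and b commutes with c. Hence `C_{b,c}^n 1 = (b -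
c)^n`, and r_a = a - c, r_b = b - c work. The f k need no contour integrals: Lagrange polynomials at
a are idempotent modulo quasinilpotents in the closed algebra generated by a, and idempotents lift.
The converse is a binomial expansion (`rho_eq_zero_of_sub_eq_sub`). -/

/-- A sequence decays fast if it is `O(ε ^ n)` for every `ε > 0`. -/
def DecaysFast {E : Type*} [NormedAddCommGroup E] (u : ℕ → E) : Prop :=
  ∀ ε : ℝ, 0 < ε → ∃ M : ℝ, 0 ≤ M ∧ ∀ n, ‖u n‖ ≤ M * ε ^ n

/-! ### Calculus of fast decay. -/

section Sequences

variable {E : Type*} [NormedAddCommGroup E]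

theorem DecaysFast.of_eventually_le {u : ℕ → E}
    (h : ∀ ε : ℝ, 0 < ε → ∀ᶠ n in atTop, ‖u n‖ ≤ ε ^ n) : DecaysFast u := by
  intro ε hε
  obtain ⟨N, hN⟩ := eventually_atTop.1 (h ε hε)
  refine ⟨1 + ∑ i ∈ Finset.range N, ‖u i‖ / ε ^ i, by positivity, fun n => ?_⟩
  rw [← div_le_iff₀ (by positivity)]
  have hsum : 0 ≤ ∑ i ∈ Finset.range N, ‖u i‖ / ε ^ i := by positivity
  rcases le_or_gt N n with hn | hn
  · have : ‖u n‖ / ε ^ n ≤ 1 := (div_le_one (by positivity)).2 (hN n hn)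
    linarith
  · have := Finset.single_le_sum (f := fun i => ‖u i‖ / ε ^ i)
      (fun i _ => by positivity) (Finset.mem_range.2 hn)
    linarith

theorem DecaysFast.eventually_le {u : ℕ → E} (h : DecaysFast u) {ε : ℝ} (hε : 0 < ε) :
    ∀ᶠ n in atTop, ‖u n‖ ≤ ε ^ n := by
  obtain ⟨M, -, hM⟩ := h (ε / 2) (by positivity)
  obtain ⟨N, hN⟩ := pow_unbounded_of_one_lt M (one_lt_two (α := ℝ))
  filter_upwards [eventually_ge_atTop N] with n hn
  have hn2 : M ≤ 2 ^ n := hN.le.trans (pow_le_pow_right₀ one_le_two hn)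
  calc ‖u n‖ ≤ M * (ε / 2) ^ n := hM n
    _ ≤ 2 ^ n * (ε / 2) ^ n := by gcongr
    _ = ε ^ n := by rw [← mul_pow]; congr 1; ring

theorem decaysFast_iff_rpow {u : ℕ → E} :
    DecaysFast u ↔ ∀ ε : ℝ, 0 < ε → ∀ᶠ n : ℕ in atTop, ‖u n‖ ^ (1 / (n : ℝ)) ≤ ε := by
  have key : ∀ ε : ℝ, 0 < ε → ∀ n : ℕ, 1 ≤ n →
      (‖u n‖ ^ (1 / (n : ℝ)) ≤ ε ↔ ‖u n‖ ≤ ε ^ n) := fun ε hε n hn => by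
    have hn0 : (0 : ℝ) < n := by exact_mod_cast hn
    rw [one_div, Real.rpow_inv_le_iff_of_pos (norm_nonneg _) hε.le hn0, Real.rpow_natCast]
  constructor
  · intro h ε hε
    filter_upwards [h.eventually_le hε, eventually_ge_atTop 1] with n h1 h2
    exact (key ε hε n h2).2 h1
  · refine fun h => .of_eventually_le fun ε hε => ?_
    filter_upwards [h ε hε, eventually_ge_atTop 1] with n h1 h2
    exact (key ε hε n h2).1 h1

theorem DecaysFast.mono {F : Type*} [NormedAddCommGroup F] {u : ℕ → E} {v : ℕ → F}
    (hu : DecaysFast u) {K R : ℝ} (hK : 0 ≤ K) (hR : 0 < R)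
    (h : ∀ n, ‖v n‖ ≤ K * R ^ n * ‖u n‖) : DecaysFast v := by
  intro ε hε
  obtain ⟨M, hM0, hM⟩ := hu (ε / R) (by positivity)
  refine ⟨K * M, by positivity, fun n => ?_⟩
  calc ‖v n‖ ≤ K * R ^ n * ‖u n‖ := h n
    _ ≤ K * R ^ n * (M * (ε / R) ^ n) := by gcongr; exact hM n
    _ = K * M * ε ^ n := by rw [div_pow]; field_simp

/-- A doubly indexed family whose Pascal-type recurrence starts from products of two fast decaying
sequences yields a fast decaying sequence. -/
theorem DecaysFast.of_recurrence {F G : Type*} [NormedAddCommGroup F] [NormedAddCommGroup G]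
    {u : ℕ → E} {v : ℕ → F} (hu : DecaysFast u) (hv : DecaysFast v) (w : ℕ → ℕ → ℕ → G) {K : ℝ}
    (hK : 0 ≤ K) (h0 : ∀ i j, ‖w 0 i j‖ ≤ K * (‖u i‖ * ‖v j‖))
    (h : ∀ n i j, ‖w (n + 1) i j‖ ≤ ‖w n (i + 1) j‖ + ‖w n i (j + 1)‖) :
    DecaysFast fun n => w n 0 0 := by
  intro ε hε
  obtain ⟨M, hM0, hM⟩ := hu (ε / 2) (by positivity)
  obtain ⟨N, hN0, hN⟩ := hv (ε / 2) (by positivity)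
  -- Unrolling n steps gives 2 ^ n terms of total degree n + i + j; decay at rate ε / 2 absorbs the
  -- 2 ^ n.
  have key : ∀ n i j, ‖w n i j‖ ≤ K * (M * N) * 2 ^ n * (ε / 2) ^ (n + i + j) := by
    intro n
    induction n with
    | zero =>
      intro i j
      calc ‖w 0 i j‖ ≤ K * (‖u i‖ * ‖v j‖) := h0 i j
        _ ≤ K * ((M * (ε / 2) ^ i) * (N * (ε / 2) ^ j)) := by
          gcongr
          · exact hM i
          · exact hN j
        _ = _ := by rw [zero_add, pow_add]; ring
    | succ n ih =>
      intro i j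
      refine (h n i j).trans ((add_le_add (ih _ _) (ih _ _)).trans (le_of_eq ?_))
      rw [show n + (i + 1) + j = n + 1 + i + j by ring,
        show n + i + (j + 1) = n + 1 + i + j by ring]
      ring
  refine ⟨K * (M * N), by positivity, fun n => (key n 0 0).trans (le_of_eq ?_)⟩
  rw [mul_assoc, add_zero, add_zero, ← mul_pow]
  congr 2
  ring

end Sequences

/-! ### Elements whose powers decay fast. -/

section Algebra

variable {A : Type*} [NormedRing A]

theorem norm_pow_le_geometric (y : A) (n : ℕ) : ‖y ^ n‖ ≤ (1 + ‖(1 : A)‖) * (1 + ‖y‖) ^ n := by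
  induction n with
  | zero => simp
  | succ n ih =>
    rw [pow_succ]
    calc ‖y ^ n * y‖ ≤ ‖y ^ n‖ * ‖y‖ := norm_mul_le _ _
      _ ≤ ((1 + ‖(1 : A)‖) * (1 + ‖y‖) ^ n) * (1 + ‖y‖) := by
        gcongr
        linarith
      _ = _ := by ring

theorem DecaysFast.pow_mul_left {x y : A} (hx : DecaysFast fun n => x ^ n) (h : Commute y x) :
    DecaysFast fun n => (y * x) ^ n :=
  hx.mono (K := 1 + ‖(1 : A)‖) (R := 1 + ‖y‖) (by positivity) (by positivity) fun n => by
    rw [h.mul_pow]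
    exact (norm_mul_le _ _).trans (by gcongr; exact norm_pow_le_geometric y n)

theorem DecaysFast.pow_add {x y : A} (hx : DecaysFast fun n => x ^ n)
    (hy : DecaysFast fun n => y ^ n) (h : Commute x y) : DecaysFast fun n => (x + y) ^ n := by
  have := hx.of_recurrence hy (fun n i j => (x + y) ^ n * (x ^ i * y ^ j)) zero_le_one
    (fun i j => by simpa using norm_mul_le (x ^ i) (y ^ j)) (fun n i j => by
      have : (x + y) ^ (n + 1) * (x ^ i * y ^ j) =
          (x + y) ^ n * (x ^ (i + 1) * y ^ j) + (x + y) ^ n * (x ^ i * y ^ (j + 1)) := by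
        have h1 : y * x ^ i = x ^ i * y := (h.pow_left i).symm
        rw [pow_succ, pow_succ' x, pow_succ' y, mul_assoc, ← mul_add, add_mul,
          ← mul_assoc y, h1]
        simp only [mul_assoc]
      rw [this]
      exact norm_add_le _ _)
  simpa using this

theorem DecaysFast.pow_neg {x : A} (hx : DecaysFast fun n => x ^ n) :
    DecaysFast fun n => (-x) ^ n := by
  simpa using hx.pow_mul_left (Commute.neg_one_left x)

theorem IsIdempotentElem.eq_zero_of_decaysFast {x : A} (h : IsIdempotentElem x)
    (hx : DecaysFast fun n => x ^ n) : x = 0 := by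
  obtain ⟨M, -, hM⟩ := hx (1 / 2) (by norm_num)
  have hlim : Tendsto (fun n : ℕ => M * (1 / 2 : ℝ) ^ n) atTop (nhds (M * 0)) :=
    (tendsto_pow_atTop_nhds_zero_of_lt_one (by norm_num) (by norm_num)).const_mul M
  rw [mul_zero] at hlim
  rw [← norm_le_zero_iff]
  refine ge_of_tendsto hlim ?_
  filter_upwards [eventually_ge_atTop 1] with n hn
  have hn' : ‖x ^ n‖ ≤ M * (1 / 2) ^ n := hM n
  rwa [h.pow_eq (by omega)] at hn'

end Algebra

/-! ### Quasinilpotence and iterated commutators. -/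

section BanachAlgebra

variable {A : Type*} [NormedRing A] [NormedAlgebra ℂ A]

theorem rho_nonneg (a b : A) : 0 ≤ rho a b :=
  le_limsup_of_frequently_le (Frequently.of_forall fun n => by positivity)
    (rho_isBoundedUnder a b)

theorem rho_eq_zero_iff (a b : A) :
    rho a b = 0 ↔ DecaysFast fun n => (commutatorOp a b ^ n) 1 := by
  rw [decaysFast_iff_rpow]
  constructor
  · intro h ε hε
    exact (eventually_lt_of_limsup_lt (h.trans_lt hε) (rho_isBoundedUnder a b)).mono
      fun n hn => hn.le
  · intro h
    refine le_antisymm (le_of_forall_pos_le_add fun ε hε => ?_) (rho_nonneg a b)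
    rw [zero_add]
    exact limsup_le_of_le (isCoboundedUnder_le_of_le atTop (x := 0) fun n => by positivity)
      (h ε hε)

theorem specDist_eq_zero_iff (a b : A) :
    specDist a b = 0 ↔ rho a b = 0 ∧ rho b a = 0 := by
  have h1 := rho_nonneg a b
  have h2 := rho_nonneg b a
  unfold specDist
  constructor
  · intro h
    exact ⟨le_antisymm (h ▸ le_max_left _ _) h1, le_antisymm (h ▸ le_max_right _ _) h2⟩
  · rintro ⟨h, h'⟩
    rw [h, h', max_self]

/-- Gelfand's spectral radius formula; nonemptiness of the spectrum excludes σ(x) = ∅. -/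
theorem isQuasinilpotent_iff_decaysFast [CompleteSpace A] [Nontrivial A] (x : A) :
    IsQuasinilpotent x ↔ DecaysFast fun n => x ^ n := by
  have hG := spectrum.pow_norm_pow_one_div_tendsto_nhds_spectralRadius x
  have h1 : IsQuasinilpotent x ↔ spectralRadius ℂ x = 0 := by
    unfold IsQuasinilpotent spectralRadius
    constructor
    · intro h
      simp [h]
    · intro h
      refine (spectrum.nonempty x).subset_singleton_iff.1 fun k hk => ?_
      simp only [ENNReal.iSup_eq_zero] at h
      simpa using h k hk
  rw [h1, decaysFast_iff_rpow]
  constructor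
  · intro h ε hε
    rw [h] at hG
    filter_upwards [hG.eventually_lt_const (ENNReal.ofReal_pos.2 hε)] with n hn
    exact ((ENNReal.ofReal_lt_ofReal_iff hε).1 hn).le
  · intro h
    refine nonpos_iff_eq_zero.1 (le_of_forall_pos_le_add fun ε hε => ?_)
    rw [zero_add]
    by_cases hε' : ε = ⊤
    · simp [hε']
    · refine le_of_tendsto hG ?_
      filter_upwards [h ε.toReal (ENNReal.toReal_pos hε.ne' hε')] with n hn
      exact ENNReal.ofReal_le_of_le_toReal hn

theorem commutatorOp_pow_succ_apply (a b x : A) (n : ℕ) :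
    (commutatorOp a b ^ (n + 1)) x = (commutatorOp a b ^ n) (commutatorOp a b x) := by
  rw [pow_succ]
  rfl

theorem commutatorOp_pow_succ_apply' (a b x : A) (n : ℕ) :
    (commutatorOp a b ^ (n + 1)) x = commutatorOp a b ((commutatorOp a b ^ n) x) := by
  rw [pow_succ']
  rfl

/-- The Leibniz rule for `commutatorOp`, iterated: fast decay is inherited by products. -/
theorem DecaysFast.commutatorOp_mul {a b c x y : A}
    (hx : DecaysFast fun n => (commutatorOp a b ^ n) x)
    (hy : DecaysFast fun n => (commutatorOp b c ^ n) y) :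
    DecaysFast fun n => (commutatorOp a c ^ n) (x * y) :=
  hx.of_recurrence hy
    (fun n i j => (commutatorOp a c ^ n) ((commutatorOp a b ^ i) x * (commutatorOp b c ^ j) y))
    zero_le_one (fun i j => by simpa using norm_mul_le _ _) fun n i j => by
      have h : commutatorOp a c ((commutatorOp a b ^ i) x * (commutatorOp b c ^ j) y) =
          (commutatorOp a b ^ (i + 1)) x * (commutatorOp b c ^ j) y +
          (commutatorOp a b ^ i) x * (commutatorOp b c ^ (j + 1)) y := by
        rw [commutatorOp_pow_succ_apply', commutatorOp_pow_succ_apply']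
        simp only [commutatorOp_apply]
        noncomm_ring
      rw [commutatorOp_pow_succ_apply, h, map_add]
      exact norm_add_le _ _

theorem commutatorOp_pow_apply_one {a b : A} (h : Commute a b) (n : ℕ) :
    (commutatorOp a b ^ n) 1 = (a - b) ^ n := by
  induction n with
  | zero => simp
  | succ n ih =>
    have : (a - b) ^ n * b = b * (a - b) ^ n :=
      ((h.sub_left (Commute.refl b)).pow_left n).eq
    rw [commutatorOp_pow_succ_apply', ih, commutatorOp_apply, this, pow_succ', sub_mul]

/-- Left multiplication by a commutes with `C_{a,b}`. -/
theorem commutatorOp_pow_apply_left (a b : A) (n : ℕ) :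
    (commutatorOp a b ^ n) a = a * (commutatorOp a b ^ n) 1 := by
  induction n with
  | zero => simp
  | succ n ih =>
    simp only [commutatorOp_pow_succ_apply', ih, commutatorOp_apply]
    noncomm_ring

/-- `C_{a,b}(r^i s^j) = r^i (a - b) s^j = r^(i+1) s^j - r^i s^(j+1)`, a Pascal-type recurrence. -/
theorem rho_eq_zero_of_sub_eq_sub {a b r s : A} (hr : DecaysFast fun n => r ^ n)
    (hs : DecaysFast fun n => s ^ n) (hra : Commute r a) (hsb : Commute s b)
    (h : a - b = r - s) : rho a b = 0 := by
  rw [rho_eq_zero_iff]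
  have key := hr.of_recurrence hs (fun n i j => (commutatorOp a b ^ n) (r ^ i * s ^ j))
    zero_le_one (fun i j => by simpa using norm_mul_le _ _) fun n i j => by
      have h1 : commutatorOp a b (r ^ i * s ^ j) = r ^ (i + 1) * s ^ j - r ^ i * s ^ (j + 1) := by
        have h2 : a * r ^ i = r ^ i * a := (hra.symm.pow_right i).eq
        have h3 : s ^ j * b = b * s ^ j := (hsb.pow_left j).eq
        calc commutatorOp a b (r ^ i * s ^ j) = (a * r ^ i) * s ^ j - r ^ i * (s ^ j * b) := by
              rw [commutatorOp_apply, mul_assoc, mul_assoc]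
          _ = r ^ i * (a - b) * s ^ j := by rw [h2, h3]; noncomm_ring
          _ = _ := by rw [h, pow_succ, pow_succ']; noncomm_ring
      rw [commutatorOp_pow_succ_apply, h1, map_sub]
      exact norm_sub_le _ _
  simpa using key

/-- If `c` is diagonalised by the family `f`, then an element on which iterated commutators with
`c` decay fast commutes with `c`. -/
theorem commute_of_decaysFast_commutatorOp_pow {b c : A} {s : Finset ℂ} {f : ℂ → A}
    (hsum : ∑ k ∈ s, f k = 1) (hl : ∀ k ∈ s, c * f k = k • f k)
    (hr : ∀ k ∈ s, f k * c = k • f k) (hb : DecaysFast fun n => (commutatorOp c c ^ n) b) :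
    Commute c b := by
  have hpow : ∀ j ∈ s, ∀ i ∈ s, ∀ n : ℕ,
      f j * (commutatorOp c c ^ n) b * f i = (j - i) ^ n • (f j * b * f i) := by
    intro j hj i hi n
    induction n with
    | zero => simp
    | succ n ih =>
      rw [commutatorOp_pow_succ_apply', commutatorOp_apply, mul_sub, sub_mul, ← mul_assoc (f j) c,
        hr j hj, ← mul_assoc, mul_assoc _ c, hl i hi, pow_succ', mul_smul, ← ih, sub_smul]
      simp only [smul_mul_assoc, mul_smul_comm]
  -- Decay at rate ‖j - i‖ / 2 beats the exact growth ‖j - i‖ ^ n of a nonzero block.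
  have hzero : ∀ j ∈ s, ∀ i ∈ s, j ≠ i → f j * b * f i = 0 := by
    intro j hj i hi hij
    have hδ : 0 < ‖j - i‖ := norm_pos_iff.2 (sub_ne_zero.2 hij)
    obtain ⟨M, hM0, hM⟩ := hb (‖j - i‖ / 2) (by positivity)
    have hlim : Tendsto (fun n : ℕ => (‖f j‖ * M * ‖f i‖) * (1 / 2 : ℝ) ^ n) atTop
        (nhds ((‖f j‖ * M * ‖f i‖) * 0)) :=
      (tendsto_pow_atTop_nhds_zero_of_lt_one (by norm_num) (by norm_num)).const_mul _
    rw [mul_zero] at hlim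
    rw [← norm_le_zero_iff]
    refine ge_of_tendsto' hlim fun n => ?_
    have h1 : ‖j - i‖ ^ n * ‖f j * b * f i‖ ≤ ‖f j‖ * (M * (‖j - i‖ / 2) ^ n) * ‖f i‖ := by
      rw [← norm_pow, ← norm_smul, ← hpow j hj i hi n]
      refine (norm_mul_le _ _).trans ?_
      gcongr
      refine (norm_mul_le _ _).trans ?_
      gcongr
      exact hM n
    refine le_of_mul_le_mul_left (h1.trans (le_of_eq ?_)) (pow_pos hδ n)
    rw [div_eq_mul_one_div, mul_pow]
    ring
  have hcomm : c * b - b * c = 0 := by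
    calc c * b - b * c = (∑ j ∈ s, f j) * (c * b - b * c) * ∑ i ∈ s, f i := by
          rw [hsum, one_mul, mul_one]
      _ = ∑ j ∈ s, ∑ i ∈ s, f j * (c * b - b * c) * f i := by
          simp only [Finset.sum_mul, Finset.mul_sum]
          exact Finset.sum_comm
      _ = 0 := Finset.sum_eq_zero fun j hj => Finset.sum_eq_zero fun i hi => by
          have := hpow j hj i hi 1
          rw [pow_one, pow_one, commutatorOp_apply] at this
          rw [this]
          by_cases hij : j = i
          · simp [hij]
          · simp [hzero j hj i hi hij]
  exact sub_eq_zero.1 hcomm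

end BanachAlgebra

/-! ### Lifting idempotents modulo quasinilpotents. -/

section Commutative

variable {B : Type*} [NormedCommRing B]

/-- The ideal of elements of a commutative normed ring whose powers decay fast. -/
def quasinilpotentIdeal (B : Type*) [NormedCommRing B] : Ideal B where
  carrier := {x | DecaysFast fun n => x ^ n}
  zero_mem' ε hε := ⟨‖(1 : B)‖, norm_nonneg _, fun n => by
    rcases n with _ | n
    · simp
    · simp only [ne_eq, Nat.add_eq_zero_iff, one_ne_zero, and_false, not_false_eq_true, zero_pow,
        norm_zero]
      positivity⟩
  add_mem' hx hy := hx.pow_add hy (Commute.all _ _)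
  smul_mem' y _ hx := hx.pow_mul_left (Commute.all y _)

theorem mem_quasinilpotentIdeal {x : B} :
    x ∈ quasinilpotentIdeal B ↔ DecaysFast fun n => x ^ n := Iff.rfl

theorem catalan_le_four_pow (n : ℕ) : catalan n ≤ 4 ^ n := by
  rw [catalan_eq_centralBinom_div]
  exact (Nat.div_le_self _ _).trans (Nat.centralBinom_le_four_pow n)

theorem summable_norm_catalan_mul_pow {x : B} (hx : x ∈ quasinilpotentIdeal B) :
    Summable fun n => ‖(catalan n : B) * x ^ n‖ := by
  obtain ⟨M, -, hM⟩ := hx (1 / 8) (by norm_num)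
  refine Summable.of_nonneg_of_le (fun n => norm_nonneg _) (fun n => ?_)
    ((summable_geometric_of_lt_one (r := 1 / 2) (by norm_num) (by norm_num)).mul_left M)
  rw [← nsmul_eq_mul]
  calc ‖catalan n • x ^ n‖ ≤ catalan n * ‖x ^ n‖ := norm_nsmul_le
    _ ≤ 4 ^ n * (M * (1 / 8) ^ n) := by
      gcongr
      · exact_mod_cast catalan_le_four_pow n
      · exact hM n
    _ = M * (4 * (1 / 8)) ^ n := by rw [mul_pow]; ring
    _ = M * (1 / 2) ^ n := by norm_num

/-- The Catalan generating function solves this quadratic; fast decay beats the bound 4 ^ n on its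
coefficients. -/
theorem exists_eq_one_add_mul_sq [CompleteSpace B] {x : B} (hx : x ∈ quasinilpotentIdeal B) :
    ∃ c : B, c = 1 + x * c ^ 2 := by
  have hs := summable_norm_catalan_mul_pow hx
  refine ⟨∑' n, (catalan n : B) * x ^ n, ?_⟩
  conv_lhs => rw [hs.of_norm.tsum_eq_zero_add]
  rw [sq, tsum_mul_tsum_eq_tsum_sum_antidiagonal_of_summable_norm hs hs,
    ← (summable_norm_sum_mul_antidiagonal_of_summable_norm hs hs).of_norm.tsum_mul_left]
  congr 1
  · simp
  · refine tsum_congr fun n => ?_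
    rw [catalan_succ', Nat.cast_sum, Finset.sum_mul, Finset.mul_sum]
    refine Finset.sum_congr rfl fun p hp => ?_
    rw [← Finset.HasAntidiagonal.mem_antidiagonal.1 hp]
    push_cast
    ring

theorem exists_mul_one_sub_eq_one [CompleteSpace B] {x : B} (hx : x ∈ quasinilpotentIdeal B) :
    ∃ y : B, y * (1 - x) = 1 := by
  obtain ⟨M, -, hM⟩ := hx (1 / 2) (by norm_num)
  have hs : Summable (x ^ ·) := Summable.of_norm_bounded
    ((summable_geometric_of_lt_one (r := 1 / 2) (by norm_num) (by norm_num)).mul_left M) hM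
  exact ⟨_, hs.tsum_pow_mul_one_sub⟩

/-- Idempotents lift modulo quasinilpotent elements. -/
theorem exists_isIdempotentElem_sub_mem [CompleteSpace B] {e : B}
    (he : e * e - e ∈ quasinilpotentIdeal B) :
    ∃ f : B, IsIdempotentElem f ∧ f - e ∈ quasinilpotentIdeal B := by
  -- With w = e² - e, y is the inverse of 1 + 4w = (2e - 1)².
  obtain ⟨y, hy⟩ := exists_mul_one_sub_eq_one (Ideal.mul_mem_left _ (-4) he)
  obtain ⟨c, hc⟩ := exists_eq_one_add_mul_sq (Ideal.mul_mem_left _ y he)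
  set w := e * e - e with hw
  -- For f = e + (2e - 1)g, f² - f = w + (1 + 4w)(g² + g), so g must solve g² + g + yw = 0; g = -ywc
  -- does.
  refine ⟨e + (2 * e - 1) * (-(y * w) * c), ?_, ?_⟩
  · have h1 : (-(y * w) * c) * (-(y * w) * c) + (-(y * w) * c) + y * w = 0 := by
      linear_combination (-(y * w)) * hc
    generalize -(y * w) * c = g at h1 ⊢
    unfold IsIdempotentElem
    linear_combination (1 + 4 * w) * h1 - w * hy + (4 * (g * g + g) + 1) * -hw
  · rw [add_sub_cancel_left]
    refine Ideal.mul_mem_left _ _ (Ideal.mul_mem_right _ _ (neg_mem (Ideal.mul_mem_left _ _ he)))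

open Polynomial in
theorem nodal_dvd_of_eval_eq_zero {s : Finset ℂ} {p : ℂ[X]} (hp : ∀ k ∈ s, p.eval k = 0) :
    Lagrange.nodal s id ∣ p :=
  Finset.prod_dvd_of_coprime
    (fun _ _ _ _ h => pairwise_coprime_X_sub_C Function.injective_id h)
    fun k hk => dvd_iff_isRoot.2 (hp k hk)

open Polynomial in
/-- An element annihilated by a polynomial with simple roots modulo quasinilpotent elements is a
quasinilpotent perturbation of a diagonalisable one. -/
theorem exists_diagonalization [NormedAlgebra ℂ B] [CompleteSpace B] {x : B} {s : Finset ℂ}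
    (hs : s.Nonempty) (hx : aeval x (Lagrange.nodal s id) ∈ quasinilpotentIdeal B) :
    ∃ f : ℂ → B, ∑ k ∈ s, f k = 1 ∧
      (∀ k ∈ s, (∑ i ∈ s, i • f i) * f k = k • f k) ∧
      x - ∑ i ∈ s, i • f i ∈ quasinilpotentIdeal B := by
  have hmem : ∀ p : ℂ[X], (∀ k ∈ s, p.eval k = 0) → aeval x p ∈ quasinilpotentIdeal B :=
    fun p hp => by
      obtain ⟨q, rfl⟩ := nodal_dvd_of_eval_eq_zero hp
      rw [map_mul]
      exact Ideal.mul_mem_right _ _ hx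
  have hinj : Set.InjOn (id : ℂ → ℂ) s := Function.injective_id.injOn
  set ℓ : ℂ → ℂ[X] := fun k => Lagrange.basis s id k with hℓ
  have hself : ∀ k ∈ s, (ℓ k).eval k = 1 := fun k hk => Lagrange.eval_basis_self hinj hk
  have hne : ∀ i, ∀ k ∈ s, i ≠ k → (ℓ i).eval k = 0 := fun i k hk h =>
    Lagrange.eval_basis_of_ne (v := id) h hk
  have hlift : ∀ k, ∃ f : B, k ∈ s →
      IsIdempotentElem f ∧ f - aeval x (ℓ k) ∈ quasinilpotentIdeal B := fun k => by
    by_cases hk : k ∈ s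
    · obtain ⟨f, hf⟩ := exists_isIdempotentElem_sub_mem (e := aeval x (ℓ k)) (by
        rw [← map_mul, ← map_sub]
        refine hmem _ fun i hi => ?_
        rcases eq_or_ne k i with rfl | h
        · simp [hself k hk]
        · simp [hne k i hi h])
      exact ⟨f, fun _ => hf⟩
    · exact ⟨0, fun h => absurd h hk⟩
  choose f hf using hlift
  -- Each product is an idempotent in the ideal, hence zero.
  have horth : ∀ i ∈ s, ∀ k ∈ s, i ≠ k → f i * f k = 0 := by
    intro i hi k hk h
    refine IsIdempotentElem.eq_zero_of_decaysFast ((hf i hi).1.mul (hf k hk).1)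
      (mem_quasinilpotentIdeal.1 ?_)
    have h1 : aeval x (ℓ i * ℓ k) ∈ quasinilpotentIdeal B := hmem _ fun j hj => by
      rcases eq_or_ne i j with rfl | h'
      · simp [hne k i hi h.symm]
      · simp [hne i j hj h']
    rw [map_mul] at h1
    have h2 := add_mem (add_mem (Ideal.mul_mem_right (f k) _ (hf i hi).2)
      (Ideal.mul_mem_left _ (aeval x (ℓ i)) (hf k hk).2)) h1
    convert h2 using 1
    ring
  have hsum_mul : ∀ g : ℂ → ℂ, ∀ k ∈ s, (∑ i ∈ s, g i • f i) * f k = g k • f k := by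
    intro g k hk
    rw [Finset.sum_mul, Finset.sum_eq_single_of_mem k hk fun i hi h => by
      rw [smul_mul_assoc, horth i hi k hk h, smul_zero], smul_mul_assoc, (hf k hk).1.eq]
  have hsum : ∑ k ∈ s, f k = 1 := by
    have hidem : IsIdempotentElem (∑ k ∈ s, f k) := by
      unfold IsIdempotentElem
      rw [Finset.mul_sum]
      refine Finset.sum_congr rfl fun k hk => ?_
      simpa using hsum_mul 1 k hk
    refine (sub_eq_zero.1 (IsIdempotentElem.eq_zero_of_decaysFast hidem.one_sub
      (mem_quasinilpotentIdeal.1 ?_))).symm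
    have h1 : ∑ k ∈ s, aeval x (ℓ k) = 1 := by
      rw [← map_sum, Lagrange.sum_basis hinj hs, map_one]
    rw [← h1, ← Finset.sum_sub_distrib]
    refine sum_mem fun k hk => ?_
    rw [← neg_sub]
    exact neg_mem (hf k hk).2
  refine ⟨f, hsum, hsum_mul id, ?_⟩
  -- `(X - C i) * ℓ i` vanishes on all of s, so every summand lies in the ideal.
  have h1 : x - ∑ i ∈ s, i • f i = ∑ i ∈ s,
      (aeval x ((X - C i) * ℓ i) + (x - algebraMap ℂ B i) * (f i - aeval x (ℓ i))) := by
    calc x - ∑ i ∈ s, i • f i = x * ∑ i ∈ s, f i - ∑ i ∈ s, i • f i := by rw [hsum, mul_one]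
      _ = _ := by
        rw [Finset.mul_sum, ← Finset.sum_sub_distrib]
        refine Finset.sum_congr rfl fun i _ => ?_
        rw [Algebra.smul_def]
        simp only [map_mul, map_sub, aeval_X, aeval_C]
        ring
  rw [h1]
  refine sum_mem fun i hi => add_mem (hmem _ fun k hk => ?_) (Ideal.mul_mem_left _ _ (hf i hi).2)
  rcases eq_or_ne i k with rfl | h
  · simp
  · simp [hne i k hk h]

end Commutative

/-! ### Diagonal part of an element with finite spectrum. -/

section BanachAlgebra

variable {A : Type*} [NormedRing A] [NormedAlgebra ℂ A]

/-- The closed subalgebra generated by an element of a Banach algebra, as a commutative normed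
ring. -/
instance elementalNormedCommRing (a : A) : NormedCommRing (Algebra.elemental ℂ a) where
  __ := (inferInstance : NormedRing (Algebra.elemental ℂ a))
  mul_comm := mul_comm

theorem exists_diagonalizable_of_finite_spectrum [CompleteSpace A] [Nontrivial A] {a : A}
    (ha : (spectrum ℂ a).Finite) :
    ∃ (c : A) (s : Finset ℂ) (f : ℂ → A), Commute c a ∧ (DecaysFast fun n => (a - c) ^ n) ∧
      ∑ k ∈ s, f k = 1 ∧ (∀ k ∈ s, c * f k = k • f k) ∧ ∀ k ∈ s, f k * c = k • f k := by
  set x : Algebra.elemental ℂ a := ⟨a, Algebra.elemental.self_mem ℂ a⟩ with hx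
  set s := ha.toFinset with hs
  have hne : s.Nonempty := ha.toFinset_nonempty.2 (spectrum.nonempty a)
  have hq : IsQuasinilpotent (Polynomial.aeval a (Lagrange.nodal s id)) := by
    unfold IsQuasinilpotent
    rw [spectrum.map_polynomial_aeval]
    refine ((spectrum.nonempty a).image _).subset_singleton_iff.1 ?_
    rintro _ ⟨k, hk, rfl⟩
    exact Lagrange.eval_nodal_at_node (v := id) (ha.mem_toFinset.2 hk)
  have hcoe : ((Polynomial.aeval x (Lagrange.nodal s id) : Algebra.elemental ℂ a) : A) =
      Polynomial.aeval a (Lagrange.nodal s id) :=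
    (Polynomial.aeval_algHom_apply (Algebra.elemental ℂ a).val x _).symm
  -- Fast decay sees only the norm, so it is unaffected by passing to the subalgebra.
  have hdec : ∀ y : Algebra.elemental ℂ a,
      y ∈ quasinilpotentIdeal (Algebra.elemental ℂ a) ↔ DecaysFast fun n => (y : A) ^ n :=
    fun y => Iff.rfl
  obtain ⟨f, hsum, hf, hr⟩ := exists_diagonalization hne
    ((hdec _).2 (hcoe ▸ (isQuasinilpotent_iff_decaysFast _).1 hq))
  set c := ∑ i ∈ s, i • f i with hc
  refine ⟨c, s, fun k => f k, ?_, ?_, ?_, fun k hk => ?_, fun k hk => ?_⟩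
  · exact congrArg Subtype.val (mul_comm c x)
  · exact (hdec _).1 hr
  · simpa using congrArg (Algebra.elemental ℂ a).val hsum
  · exact congrArg Subtype.val (hf k hk)
  · exact congrArg Subtype.val ((mul_comm (f k) c).trans (hf k hk))

end BanachAlgebra

end QuasinilpotentEquivalence

end

open QuasinilpotentEquivalence in
theorem mainTheorem2 {A : Type*} [NormedRing A] [NormedAlgebra ℂ A] [CompleteSpace A]
    [Nontrivial A] (a b : A) (ha : (spectrum ℂ a).Finite) :
    QuasinilpotentEquivalence.specDist a b = 0 ↔
      ∃ r_a r_b : A,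
        QuasinilpotentEquivalence.IsQuasinilpotent r_a ∧
        QuasinilpotentEquivalence.IsQuasinilpotent r_b ∧
        Commute r_a a ∧ Commute r_b b ∧
        a - b = r_a - r_b := by
  rw [specDist_eq_zero_iff]
  constructor
  · rw [rho_eq_zero_iff, rho_eq_zero_iff]
    rintro ⟨hab, hba⟩
    obtain ⟨c, s, f, hca, hac, hsum, hl, hr⟩ := exists_diagonalizable_of_finite_spectrum ha
    have hca' : DecaysFast fun n => (commutatorOp c a ^ n) 1 := by
      simp only [commutatorOp_pow_apply_one hca]
      simpa using hac.pow_neg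
    have hac' : DecaysFast fun n => (commutatorOp a c ^ n) 1 := by
      simpa only [commutatorOp_pow_apply_one hca.symm] using hac
    have hcb : DecaysFast fun n => (commutatorOp c b ^ n) 1 := by
      simpa using hca'.commutatorOp_mul hab
    have hbc : DecaysFast fun n => (commutatorOp b c ^ n) 1 := by
      simpa using hba.commutatorOp_mul hac'
    have hbc' : DecaysFast fun n => (commutatorOp b c ^ n) b :=
      hbc.mono (K := ‖b‖) (R := 1) (norm_nonneg _) one_pos fun n => by
        rw [commutatorOp_pow_apply_left, one_pow, mul_one]
        exact norm_mul_le _ _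
    have hcomm : Commute c b := commute_of_decaysFast_commutatorOp_pow hsum hl hr
      (by simpa using hcb.commutatorOp_mul hbc')
    refine ⟨a - c, b - c, (isQuasinilpotent_iff_decaysFast _).2 hac,
      (isQuasinilpotent_iff_decaysFast _).2 ?_, (Commute.refl a).sub_left hca,
      (Commute.refl b).sub_left hcomm, by abel⟩
    simpa only [commutatorOp_pow_apply_one hcomm.symm] using hbc
  · rintro ⟨r, t, hr, ht, hra, htb, h⟩
    rw [isQuasinilpotent_iff_decaysFast] at hr ht
    exact ⟨rho_eq_zero_of_sub_eq_sub hr ht hra htb h,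
      rho_eq_zero_of_sub_eq_sub ht hr htb hra (by rw [← neg_sub a, h, neg_sub])⟩
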